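/- Let $G$ be a group and let $\hat G=\varprojlim G/N$ be its profinite completion, where $N$ runs over the normal subgroups of finite index in $G$. Give $G$ the discrete topology and $\hat G$ the inverse limit topology of the discrete groups $G/N$. A finite $G$-module is a finite abelian group $M$ with the discrete topology and an action of $G$ by group automorphisms. The action map $G\to\operatorname{Aut}(M)$ factors over $\hat G$, so $M$ is also a topological $\hat G$-module, and the canonical map $G\to\hat G$ induces restriction maps $$H^p(\hat G,M)\longrightarrow H^p(G,M),\qquad p\ge 0,$$ on cohomology defined by continuous cochains. The group $G$ is called good (in Serre's sense) if these maps are bijective for all integers $p\ge 0$ and all finite $G$-modules $M$. The group $G$ is called almost free if it contains a free subgroup of finite index (the free subgroup may have any rank, finite or infinite, including $0$). Proposition. Every almost free group is good. -/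

import Mathlib

open CategoryTheory

universe u

namespace SerreGood

/-- A group is almost free if it contains a free subgroup of finite index. -/
def IsAlmostFree (G : Type u) [Group G] : Prop :=
  ∃ F : Subgroup G, IsFreeGroup F ∧ F.FiniteIndex

/-- The profinite completion `lim G ⧸ N` of `G`, where `N` runs through the normal subgroups of
finite index, with the inverse limit topology. -/
abbrev Completion (G : Type u) [Group G] : ProfiniteGrp.{u} :=
  ProfiniteGrp.ProfiniteCompletion.completion (GrpCat.of G)

/-- The canonical homomorphism `G → lim G ⧸ N`, for `G` a discrete group. -/
def toCompletion (G : Type u) [Group G] [TopologicalSpace G] [DiscreteTopology G] :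
    G →ₜ* Completion G where
  toMonoidHom := (ProfiniteGrp.ProfiniteCompletion.eta (GrpCat.of G)).hom
  continuous_toFun := continuous_of_discreteTopology

section Action

variable (G : Type u) [Group G] (M : Type u) [AddCommGroup M] [Finite M] [DistribMulAction G M]

/-- The normal subgroup of finite index of those elements of `G` that act trivially on a finite
`G`-module `M`. -/
def actionKernel : FiniteIndexNormalSubgroup G where
  toSubgroup := (DistribMulAction.toAddMonoidEnd G M).ker
  isFiniteIndex' := by
    have : Finite (AddMonoid.End M) :=
      Finite.of_injective (fun e : AddMonoid.End M => (e : M → M)) DFunLike.coe_injective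
    have h : (DistribMulAction.toAddMonoidEnd G M).ker =
        (DistribMulAction.toAddMonoidEnd G M).toHomUnits.ker := by
      ext g
      simp [MonoidHom.mem_ker]
    rw [h]
    exact Subgroup.finiteIndex_ker _

/-- A finite `G`-module is a module over the quotient of `G` by the kernel of the action. -/
def quotientAction : G ⧸ (actionKernel G M).toSubgroup →* AddMonoid.End M :=
  QuotientGroup.lift _ (DistribMulAction.toAddMonoidEnd G M) fun _ h => h

/-- The action of the profinite completion of `G` on a finite `G`-module `M`: as `G → Aut(M)`
factors over the finite quotient of `G` by its kernel, compose the projection of the completion to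
this quotient with the resulting action of the quotient on `M`. -/
def completionAction : Completion G →* AddMonoid.End M where
  toFun x := quotientAction G M (x.1 (actionKernel G M))
  map_one' := map_one (quotientAction G M)
  map_mul' x y := map_mul (quotientAction G M) (x.1 (actionKernel G M)) (y.1 (actionKernel G M))

/-- The action of the completion extends the action of `G`. -/
theorem completionAction_toCompletion [TopologicalSpace G] [DiscreteTopology G] (g : G) :
    completionAction G M (toCompletion G g) = DistribMulAction.toAddMonoidEnd G M g := rfl

/-- The action of the completion on the discrete group `M` is continuous. -/
theorem continuous_completionAction [TopologicalSpace M] [DiscreteTopology M] :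
    Continuous fun q : Completion G × M => completionAction G M q.1 q.2 := by
  have h : Continuous fun x : Completion G => x.1 (actionKernel G M) :=
    (continuous_apply (actionKernel G M)).comp continuous_subtype_val
  have : DiscreteTopology ((ProfiniteGrp.ProfiniteCompletion.diagram (GrpCat.of G)).obj
    (actionKernel G M)) := ⟨rfl⟩
  have h2 : Continuous fun q : ((ProfiniteGrp.ProfiniteCompletion.diagram (GrpCat.of G)).obj
      (actionKernel G M)) × M =>
      quotientAction G M q.1 q.2 :=
    continuous_of_discreteTopology
  exact h2.comp ((h.comp continuous_fst).prodMk continuous_snd)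

end Action

/-- An action of a group `Γ` on a discrete abelian group `M`, as a topological representation of
`Γ` over the discrete ring `ℤ`. -/
abbrev discreteRep {Γ : Type u} [Group Γ] {M : Type u} [AddCommGroup M] [TopologicalSpace M]
    [DiscreteTopology M] (φ : Γ →* AddMonoid.End M) : TopRep.{u} ℤ Γ :=
  TopRep.of (ContRepresentation.ofMonoidHom
    { toFun := fun g => ⟨AddMonoidHom.toIntLinearMap (φ g), continuous_of_discreteTopology⟩
      map_one' := by ext m; exact DFunLike.congr_fun (map_one φ) m
      map_mul' := fun g h => by ext m; exact DFunLike.congr_fun (map_mul φ g h) m })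

section Restriction

variable (G : Type u) [Group G] [TopologicalSpace G] [DiscreteTopology G]
  (M : Type u) [AddCommGroup M] [TopologicalSpace M] [DiscreteTopology M] [Finite M]
  [DistribMulAction G M]

/-- The finite discrete `G`-module `M`. -/
abbrev groupRep : TopRep.{u} ℤ G := discreteRep (DistribMulAction.toAddMonoidEnd G M)

/-- The finite discrete `G`-module `M`, as a module over the profinite completion of `G`. -/
abbrev completionRep : TopRep.{u} ℤ (Completion G) := discreteRep (completionAction G M)

/-- Restricted to `G`, the module `M` over the completion is the `G`-module `M` itself; this is
the identity map of `M`. -/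
def resToGroupRep :
    TopRep.res (toCompletion G : G →* Completion G) (completionRep G M) ⟶ groupRep G M :=
  TopRep.ofHom
    { toContinuousLinearMap := ContinuousLinearMap.id ℤ M
      isIntertwining' := fun _ => rfl }

/-- The restriction map `H^p(Ĝ, M) → H^p(G, M)` on continuous cohomology: on cochains, it is
composition with the canonical map `G → Ĝ`. -/
noncomputable def restriction (p : ℕ) :
    continuousCohomology p (completionRep G M) ⟶ continuousCohomology p (groupRep G M) :=
  ContinuousCohomology.map (toCompletion G) (resToGroupRep G M) p

end Restriction

/-- A group `G`, with the discrete topology, is good if the restriction map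
`H^p(Ĝ, M) → H^p(G, M)` is bijective for all `p ≥ 0` and all finite discrete `G`-modules `M`. -/
def IsGood (G : Type u) [Group G] : Prop :=
  ∀ [TopologicalSpace G] [DiscreteTopology G] (M : Type u) [AddCommGroup M] [TopologicalSpace M]
    [DiscreteTopology M] [Finite M] [DistribMulAction G M] (p : ℕ),
    Function.Bijective (restriction G M p)

end SerreGood

/-! Call a cochain on `G` uniform if it factors through a finite quotient of `G`. Since the
completion is compact and the image of `G` meets every fibre over a finite quotient, equivariant
uniform cochains on `G` are exactly the restrictions of invariant continuous cochains on the
completion (`restrictCochain_injective`, `restrictCochain_isUniform`,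
`exists_invariant_restrictCochain_eq`).

Goodness then reduces to `exists_coboundary_isUniform_sub`: an equivariant cochain with uniform
coboundary becomes uniform after subtracting a coboundary. Applied to a cocycle it gives
surjectivity; applied to a primitive of a restricted cochain it gives injectivity in positive
degrees. In degree 0 injectivity is already visible on cochains.

That statement is proved by dimension shifting. Over some subgroup `H` of finite index, the cochain
is a coboundary plus a uniform cochain (`exists_primitive_mod_uniform`): in degree 1 because a
crossed homomorphism into a finite module vanishes on such a subgroup, in higher degrees because
free groups have no cohomology there (`exists_primitive_of_isFreeGroup`). Inducing from `H` to `G`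
turns the primitive into a cochain with values in functions on `G ⧸ H`. Modulo constants its
coboundary is uniform and its degree is one lower, so induction applies. All coefficient modules in
this induction stay finite. -/

namespace SerreGood

/-! ### Homogeneous cochains and the simplicial coboundary -/

section Cochains

variable {X Y A B : Type*} [AddCommGroup A] [AddCommGroup B] {n : ℕ}

/-- The simplicial coboundary of a function on `n`-tuples. -/
def coboundary (f : (Fin n → X) → A) : (Fin (n + 1) → X) → A :=
  fun x => ∑ i : Fin (n + 1), (-1 : ℤ) ^ (i : ℕ) • f (fun j => x (i.succAbove j))

/-- Splitting off the face that omits the first vertex gives a recursion in the number of variables.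
It drives the cone construction and matches the recursive differential on iterated continuous
functions. -/
theorem coboundary_cons (f : (Fin (n + 1) → X) → A) (x : X) (xs : Fin (n + 1) → X) :
    coboundary f (Fin.cons x xs : Fin (n + 2) → X) =
      f xs - coboundary (fun ys : Fin n → X => f (Fin.cons x ys : Fin (n + 1) → X)) xs := by
  unfold coboundary
  rw [Fin.sum_univ_succ, sub_eq_add_neg, ← Finset.sum_neg_distrib]
  congr 1
  · simp
  · refine Finset.sum_congr rfl fun i _ => ?_
    rw [Fin.val_succ, pow_succ, mul_neg_one, neg_smul]
    congr 3
    funext j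
    refine Fin.cases ?_ (fun j => ?_) j <;> simp

theorem coboundary_zero_apply (f : (Fin 0 → X) → A) (x : Fin 1 → X) :
    coboundary f x = f ![] := by
  have h (y : Fin 0 → X) : f y = f ![] := congrArg f (Subsingleton.elim _ _)
  simp [coboundary, h]

theorem coboundary_sub (f g : (Fin n → X) → A) :
    coboundary (f - g) = coboundary f - coboundary g := by
  funext x
  simp [coboundary, smul_sub]

theorem coboundary_zero : coboundary (0 : (Fin n → X) → A) = 0 := by
  funext x
  simp [coboundary]

theorem map_coboundary (φ : A →+ B) (f : (Fin n → X) → A) :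
    coboundary (fun x => φ (f x)) = fun x => φ (coboundary f x) := by
  funext x
  simp [coboundary]

theorem coboundary_coboundary (f : (Fin n → X) → A) : coboundary (coboundary f) = 0 := by
  induction n with
  | zero =>
    funext x
    rw [← Fin.cons_self_tail x, coboundary_cons, coboundary_zero_apply, coboundary_zero_apply,
      coboundary_zero_apply]
    simp
  | succ n ih =>
    funext x
    rw [← Fin.cons_self_tail x, coboundary_cons]
    have : (fun ys : Fin (n + 1) → X => coboundary f (Fin.cons (x 0) ys : Fin (n + 2) → X)) =
        f - coboundary (fun ys : Fin n → X => f (Fin.cons (x 0) ys : Fin (n + 1) → X)) := by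
      funext ys
      rw [coboundary_cons]
      rfl
    rw [this, coboundary_sub, ih]
    simp

/-- The cone of a cocycle from a point is a primitive. -/
theorem coboundary_cone {f : (Fin (n + 1) → X) → A} (hf : coboundary f = 0) (x : X) :
    coboundary (fun ys : Fin n → X => f (Fin.cons x ys : Fin (n + 1) → X)) = f := by
  funext xs
  have := congrFun hf (Fin.cons x xs : Fin (n + 2) → X)
  rw [coboundary_cons, Pi.zero_apply, sub_eq_zero] at this
  exact this.symm

theorem coboundary_apply_apply (f : (Fin n → X) → Y → A) (x : Fin (n + 1) → X) (y : Y) :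
    coboundary f x y = coboundary (fun z => f z y) x :=
  (congrFun (map_coboundary (Pi.evalAddMonoidHom (fun _ : Y => A) y) f) x).symm

end Cochains

/-! ### Equivariant cochains, affine actions and the cohomology of free groups -/

section Equivariant

variable {Γ X Y A B : Type*} [Group Γ] [MulAction Γ X] [MulAction Γ Y] [AddCommGroup A]
  [AddCommGroup B] {n : ℕ}

/-- Equivariance of a function with values in a `Γ`-module. -/
def IsEquivariant (ρ : Γ →* AddMonoid.End A) (f : X → A) : Prop :=
  ∀ (g : Γ) (x : X), f (g • x) = ρ g (f x)

theorem end_mul_apply (ρ : Γ →* AddMonoid.End A) (g h : Γ) (a : A) :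
    ρ (g * h) a = ρ g (ρ h a) := by
  rw [map_mul]; rfl

theorem end_one_apply (ρ : Γ →* AddMonoid.End A) (a : A) : ρ 1 a = a := by
  rw [map_one]; rfl

theorem end_inv_apply (ρ : Γ →* AddMonoid.End A) (g : Γ) (a : A) : ρ g (ρ g⁻¹ a) = a := by
  rw [← end_mul_apply, mul_inv_cancel, end_one_apply]

theorem smul_fin_cons (g : Γ) (x : X) (xs : Fin n → X) :
    g • (Fin.cons x xs : Fin (n + 1) → X) = Fin.cons (g • x) (g • xs) := by
  funext i
  exact Fin.cases rfl (fun _ => rfl) i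

variable {ρ : Γ →* AddMonoid.End A}

theorem IsEquivariant.sub {f f' : X → A} (hf : IsEquivariant ρ f) (hf' : IsEquivariant ρ f') :
    IsEquivariant ρ (f - f') := fun g x => by
  simp [hf g x, hf' g x]

theorem IsEquivariant.coboundary {f : (Fin n → X) → A} (hf : IsEquivariant ρ f) :
    IsEquivariant ρ (coboundary f) := fun g x => by
  simp only [SerreGood.coboundary, map_sum, map_zsmul]
  exact Finset.sum_congr rfl fun i _ => by rw [← hf]; rfl

theorem IsEquivariant.map {σ : Γ →* AddMonoid.End B} {φ : A →+ B}
    (hφ : ∀ g a, φ (ρ g a) = σ g (φ a)) {f : X → A} (hf : IsEquivariant ρ f) :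
    IsEquivariant σ (fun x => φ (f x)) := fun g x => by
  simp only [hf g x, hφ]

theorem IsEquivariant.of_map {σ : Γ →* AddMonoid.End B} {φ : A →+ B}
    (hφ : ∀ g a, φ (ρ g a) = σ g (φ a)) (inj : Function.Injective φ) {f : X → A}
    (hf : IsEquivariant σ (fun x => φ (f x))) : IsEquivariant ρ f := fun g x =>
  inj ((hf g x).trans (hφ g _).symm)

/-- Equivariant functions lift along equivariant surjections of `Γ`-sets if stabilizers act
trivially on the target. -/
theorem exists_equivariant_lift {S T : Type*} (σ : Γ →* Function.End S) (τ : Γ →* Function.End T)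
    {π : S → T} (hπ : Function.Surjective π) (h : ∀ g s, π (σ g s) = τ g (π s))
    (hst : ∀ (g : Γ) (x : X), g • x = x → σ g = 1)
    (f : X → T) (hf : ∀ (g : Γ) x, f (g • x) = τ g (f x)) :
    ∃ f' : X → S, (∀ (g : Γ) x, f' (g • x) = σ g (f' x)) ∧ ∀ x, π (f' x) = f x := by
  classical
  -- Lift `f` at one representative `r x` of each orbit and transport by some `t x` with `t x • r x
  -- = x`. Two choices of `t x` differ by a stabilizer element, which acts trivially on `S`.
  let r : X → X := fun x => Quotient.out (s := MulAction.orbitRel Γ X) ⟦x⟧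
  have hr : ∀ x, ∃ g : Γ, g • r x = x := fun x =>
    MulAction.orbitRel_apply.1
      ((MulAction.orbitRel Γ X).symm (Quotient.mk_out (s := MulAction.orbitRel Γ X) x))
  have hr' : ∀ (g : Γ) x, r (g • x) = r x := fun g x => by
    have : Quotient.mk (MulAction.orbitRel Γ X) (g • x) = Quotient.mk (MulAction.orbitRel Γ X) x :=
      Quotient.sound (s := MulAction.orbitRel Γ X)
        (MulAction.orbitRel_apply.2 (MulAction.mem_orbit x g))
    simp only [r, this]
  choose t ht using hr
  choose l hl using hπ
  refine ⟨fun x => σ (t x) (l (f (r x))), fun g x => ?_, fun x => ?_⟩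
  · have h1 : ((t (g • x))⁻¹ * (g * t x)) • r x = r x := by
      rw [mul_smul, mul_smul, ht x, inv_smul_eq_iff, ← hr' g x, ht]
    have h2 : σ (g * t x) = σ (t (g • x)) := by
      rw [← mul_inv_cancel_left (t (g • x)) (g * t x), map_mul, hst _ _ h1, mul_one]
    simp only [hr']
    rw [← h2, map_mul]
    rfl
  · rw [h, hl, ← hf, ht]

/-- The underlying self-map of an endomorphism. -/
def endToFunctionEnd (A : Type*) [AddCommGroup A] : AddMonoid.End A →* Function.End A where
  toFun e a := e a
  map_one' := rfl
  map_mul' _ _ := rfl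

theorem IsEquivariant.exists_lift {σ : Γ →* AddMonoid.End B} {φ : A →+ B}
    (hφ : ∀ g a, φ (ρ g a) = σ g (φ a)) (surj : Function.Surjective φ)
    (hst : ∀ (g : Γ) (x : X), g • x = x → ρ g = 1) {f : X → B} (hf : IsEquivariant σ f) :
    ∃ f' : X → A, IsEquivariant ρ f' ∧ ∀ x, φ (f' x) = f x := by
  refine exists_equivariant_lift ((endToFunctionEnd A).comp ρ)
    ((endToFunctionEnd B).comp σ) surj hφ ?_ f hf
  intro g x hx
  rw [MonoidHom.comp_apply, hst g x hx, map_one]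

/-- The module of functions from a `Γ`-set to a `Γ`-module, with the diagonal action. -/
def funEnd (Y : Type*) [MulAction Γ Y] (ρ : Γ →* AddMonoid.End A) :
    Γ →* AddMonoid.End (Y → A) where
  toFun g := AddMonoidHom.mk' (fun φ y => ρ g (φ (g⁻¹ • y))) fun φ ψ => by funext y; simp
  map_one' := by
    refine AddMonoidHom.ext fun φ => funext fun y => ?_
    change ρ 1 (φ ((1 : Γ)⁻¹ • y)) = φ y
    rw [end_one_apply, inv_one, one_smul]
  map_mul' g h := by
    refine AddMonoidHom.ext fun φ => funext fun y => ?_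
    change ρ (g * h) (φ ((g * h)⁻¹ • y)) = ρ g (ρ h (φ (h⁻¹ • g⁻¹ • y)))
    rw [end_mul_apply, mul_inv_rev, mul_smul]

@[simp]
theorem funEnd_apply (g : Γ) (φ : Y → A) (y : Y) :
    funEnd Y ρ g φ y = ρ g (φ (g⁻¹ • y)) := rfl

/-- The embedding of a module as the constant functions. -/
def constHom (Y A : Type*) [AddCommGroup A] : A →+ (Y → A) where
  toFun a := fun _ => a
  map_zero' := rfl
  map_add' _ _ := rfl

@[simp]
theorem constHom_apply (a : A) (y : Y) : constHom Y A a y = a := rfl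

theorem constHom_injective [Nonempty Y] : Function.Injective (constHom Y A) :=
  fun _ _ h => congrFun h (Classical.arbitrary Y)

theorem constHom_equivariant (g : Γ) (a : A) :
    constHom Y A (ρ g a) = funEnd Y ρ g (constHom Y A a) := rfl

/-- Functions modulo constant functions. -/
abbrev FunModConst (Y A : Type*) [AddCommGroup A] := (Y → A) ⧸ (constHom Y A).range

/-- The action on functions modulo constants. -/
def funModConstEnd (Y : Type*) [MulAction Γ Y] (ρ : Γ →* AddMonoid.End A) :
    Γ →* AddMonoid.End (FunModConst Y A) where
  toFun g := QuotientAddGroup.map _ _ (funEnd Y ρ g) (by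
    rintro _ ⟨a, rfl⟩
    exact ⟨ρ g a, rfl⟩)
  map_one' := by
    refine AddMonoidHom.ext fun q => ?_
    induction q using QuotientAddGroup.induction_on with
    | H φ => exact congrArg (QuotientAddGroup.mk' _) (end_one_apply (funEnd Y ρ) φ)
  map_mul' g h := by
    refine AddMonoidHom.ext fun q => ?_
    induction q using QuotientAddGroup.induction_on with
    | H φ => exact congrArg (QuotientAddGroup.mk' _) (end_mul_apply (funEnd Y ρ) g h φ)

/-- The projection to functions modulo constants. -/
def modConst (Y A : Type*) [AddCommGroup A] : (Y → A) →+ FunModConst Y A :=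
  QuotientAddGroup.mk' _

theorem modConst_surjective : Function.Surjective (modConst Y A) :=
  QuotientAddGroup.mk'_surjective _

theorem modConst_equivariant (g : Γ) (φ : Y → A) :
    modConst Y A (funEnd Y ρ g φ) = funModConstEnd Y ρ g (modConst Y A φ) := rfl

theorem modConst_eq_zero {φ : Y → A} : modConst Y A φ = 0 ↔ ∃ a, constHom Y A a = φ := by
  rw [← AddMonoidHom.mem_range, modConst, ← AddMonoidHom.mem_ker, QuotientAddGroup.ker_mk']

theorem modConst_constHom (a : A) : modConst Y A (constHom Y A a) = 0 :=
  modConst_eq_zero.2 ⟨a, rfl⟩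

/-- A function to `Y → A` that vanishes modulo constants comes from a function to `A`. -/
theorem exists_eq_constHom [Nonempty Y] {f : X → Y → A} (hf : IsEquivariant (funEnd Y ρ) f)
    (h : ∀ x, modConst Y A (f x) = 0) :
    ∃ w : X → A, IsEquivariant ρ w ∧ f = fun x => constHom Y A (w x) := by
  choose w hw using fun x => modConst_eq_zero.1 (h x)
  have hw' : f = fun x => constHom Y A (w x) := funext fun x => (hw x).symm
  exact ⟨w, .of_map (σ := funEnd Y ρ) constHom_equivariant constHom_injective (hw' ▸ hf), hw'⟩

/-- The affine action attached to a crossed homomorphism. -/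
def affineEnd (ρ : Γ →* AddMonoid.End A) (β : Γ → A) (hβ : ∀ g h, β (g * h) = β g + ρ g (β h)) :
    Γ →* Function.End A where
  toFun g a := ρ g a + β g
  map_one' := by
    have : β 1 = 0 := by simpa using hβ 1 1
    funext a
    rw [end_one_apply, this, add_zero]
    rfl
  map_mul' g h := by
    funext a
    simp only [hβ, end_mul_apply]
    change _ = ρ g (ρ h a + β h) + β g
    rw [map_add]
    abel

@[simp]
theorem affineEnd_apply {β : Γ → A} (hβ : ∀ g h, β (g * h) = β g + ρ g (β h)) (g : Γ) (a : A) :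
    affineEnd ρ β hβ g a = ρ g a + β g := rfl

/-- An equivariant 1-cocycle is the difference of a function equivariant for an affine action. -/
theorem exists_affine_primitive [Nonempty X] {z : (Fin 2 → X) → A} (hz : IsEquivariant ρ z)
    (dz : coboundary z = 0) :
    ∃ (b : (Fin 1 → X) → A) (β : Γ → A) (hβ : ∀ g h, β (g * h) = β g + ρ g (β h)),
      (∀ (g : Γ) x, b (g • x) = affineEnd ρ β hβ g (b x)) ∧ coboundary b = z := by
  obtain ⟨x₀⟩ := ‹Nonempty X›
  -- The cone from `x₀` is not equivariant, because `g` moves the base point. The defect is the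
  -- constant `b (g • ![x₀])`, which is the crossed homomorphism.
  let b : (Fin 1 → X) → A := fun ys => z (Fin.cons x₀ ys : Fin 2 → X)
  have hb : coboundary b = z := coboundary_cone dz x₀
  have key : ∀ (g : Γ) x, b (g • x) = ρ g (b x) + b (g • ![x₀]) := fun g x => by
    have h1 : z (g • (Fin.cons x₀ x : Fin 2 → X)) = ρ g (b x) := hz g _
    have h3 : coboundary b (Fin.cons (g • x₀) (g • x) : Fin 2 → X) =
        b (g • x) - b (g • ![x₀]) := by
      rw [coboundary_cons, coboundary_zero_apply]
      congr 2
      funext i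
      fin_cases i
      rfl
    rw [← h1, smul_fin_cons, ← hb, h3]
    abel
  have hβ : ∀ g h : Γ, b ((g * h) • ![x₀]) = b (g • ![x₀]) + ρ g (b (h • ![x₀])) :=
    fun g h => by rw [mul_smul, key, add_comm]
  exact ⟨b, fun g => b (g • ![x₀]), hβ, key, hb⟩

/-- An equivariant 1-cocycle with values in a finite module becomes trivial on a subgroup of finite
index. -/
theorem exists_subgroup_primitive [Nonempty X] [Finite A] {z : (Fin 2 → X) → A}
    (hz : IsEquivariant ρ z) (dz : coboundary z = 0) :
    ∃ K : Subgroup Γ, K.FiniteIndex ∧ ∃ k : (Fin 1 → X) → A,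
      IsEquivariant (ρ.comp K.subtype) k ∧ coboundary k = z := by
  obtain ⟨b, β, hβ, hb, db⟩ := exists_affine_primitive hz dz
  -- The affine action permutes the finite set `A`, so its kernel has finite index. An element of
  -- the kernel fixes `0`, hence `β` vanishes there and `b` is equivariant.
  refine ⟨(affineEnd ρ β hβ).toHomPerm.ker, Subgroup.finiteIndex_ker _, b, ?_, db⟩
  rintro ⟨g, hg⟩ x
  have h : ∀ a, ρ g a + β g = a := fun a => Equiv.congr_fun (MonoidHom.mem_ker.1 hg) a
  have h0 : β g = 0 := by simpa using h 0
  have h1 : b (g • x) = ρ g (b x) + β g := hb g x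
  change b (g • x) = ρ g (b x)
  rw [h1, h0, add_zero]

/-- Crossed homomorphisms of free groups lift along surjections of modules. -/
theorem exists_crossedHom_lift [IsFreeGroup Γ] {σ : Γ →* AddMonoid.End B} {φ : A →+ B}
    (hφ : ∀ g a, φ (ρ g a) = σ g (φ a)) (surj : Function.Surjective φ) {β : Γ → B}
    (hβ : ∀ g h, β (g * h) = β g + σ g (β h)) :
    ∃ β' : Γ → A, (∀ g h, β' (g * h) = β' g + ρ g (β' h)) ∧ ∀ g, φ (β' g) = β g := by
  have hβ1 : β 1 = 0 := by simpa using hβ 1 1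
  -- A crossed homomorphism is an action by affine maps, recovered from its values at `0`. Pairs of
  -- `g` and an affine map over `g` whose translation part lifts `β g` form a group over `Γ`;
  -- freeness yields a section of its projection.
  let S : Subgroup (Γ × Equiv.Perm A) :=
    { carrier := {p | ∃ b, φ b = β p.1 ∧ ∀ a, p.2 a = ρ p.1 a + b}
      one_mem' := ⟨0, by simp [hβ1], fun a => by simp⟩
      mul_mem' := by
        rintro ⟨g, s⟩ ⟨h, t⟩ ⟨b, hb, hs⟩ ⟨c, hc, ht⟩
        simp only at hb hc hs ht
        refine ⟨b + ρ g c, ?_, fun a => ?_⟩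
        · simp [hb, hφ, hc, hβ]
        · simp only [Prod.mk_mul_mk, Equiv.Perm.mul_apply, hs, ht, end_mul_apply, map_add]
          abel
      inv_mem' := by
        rintro ⟨g, s⟩ ⟨b, hb, hs⟩
        simp only at hb hs
        refine ⟨-ρ g⁻¹ b, ?_, fun a => ?_⟩
        · have := hβ g⁻¹ g
          rw [inv_mul_cancel, hβ1] at this
          simp only [map_neg, hφ, hb, Prod.fst_inv]
          exact (eq_neg_of_add_eq_zero_left this.symm).symm
        · rw [Prod.snd_inv, Equiv.Perm.inv_eq_iff_eq, hs]
          simp only [Prod.fst_inv, map_add, map_neg, end_inv_apply]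
          abel }
  choose l hl using surj
  let T : Γ → A → Equiv.Perm A := fun g b =>
    { toFun := fun a => ρ g a + b
      invFun := fun a => ρ g⁻¹ (a - b)
      left_inv := fun a => by
        simp only [add_sub_cancel_right, ← end_mul_apply, inv_mul_cancel, end_one_apply]
      right_inv := fun a => by simp only [end_inv_apply, sub_add_cancel] }
  let F : Γ →* S := IsFreeGroup.lift fun s =>
    ⟨(IsFreeGroup.of s, T (IsFreeGroup.of s) (l (β (IsFreeGroup.of s)))), _, hl _, fun _ => rfl⟩
  have hF : ∀ g, (F g).1.1 = g := fun g => by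
    have : ((MonoidHom.fst _ _).comp S.subtype).comp F = MonoidHom.id Γ := by
      refine IsFreeGroup.ext_hom fun s => ?_
      simp [F]
    exact DFunLike.congr_fun this g
  choose b hb hb' using fun g => (F g).2
  simp only [hF] at hb hb'
  have hT : ∀ g, (F g).1.2 0 = b g := fun g => by rw [hb', map_zero, zero_add]
  refine ⟨b, fun g h => ?_, hb⟩
  rw [← hT (g * h), map_mul]
  change (F g).1.2 ((F h).1.2 0) = _
  rw [hT, hb', add_comm]

/-- The cohomology of a free group vanishes in degrees at least two. -/
theorem exists_primitive_of_isFreeGroup {Γ X : Type u} [Group Γ] [IsFreeGroup Γ] [MulAction Γ X]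
    [Nonempty X] (hfree : ∀ (g : Γ) (x : X), g • x = x → g = 1) (n : ℕ) :
    ∀ {A : Type u} [AddCommGroup A] {ρ : Γ →* AddMonoid.End A} {z : (Fin (n + 3) → X) → A},
      IsEquivariant ρ z → coboundary z = 0 →
      ∃ k : (Fin (n + 2) → X) → A, IsEquivariant ρ k ∧ coboundary k = z := by
  have free' : ∀ {m : ℕ} {C : Type u} [AddCommGroup C] (ρ : Γ →* AddMonoid.End C) (g : Γ)
      (x : Fin (m + 1) → X), g • x = x → g = 1 := fun _ g x h =>
    hfree g (x 0) (congrFun h 0)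
  -- Dimension shifting: the cone `κ` with variable apex is an equivariant primitive of `z` with
  -- values in `X → A`. If its class modulo constants lifts to a cocycle `w'`, then `κ - w'` takes
  -- constant values and is a primitive of `z` in `A`.
  have descend : ∀ {m : ℕ} {A : Type u} [AddCommGroup A] {ρ : Γ →* AddMonoid.End A}
      {z : (Fin (m + 3) → X) → A}, IsEquivariant ρ z → coboundary z = 0 →
      (∀ w : (Fin (m + 2) → X) → FunModConst X A, IsEquivariant (funModConstEnd X ρ) w →
        coboundary w = 0 → ∃ w' : (Fin (m + 2) → X) → X → A, IsEquivariant (funEnd X ρ) w' ∧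
          coboundary w' = 0 ∧ ∀ x, modConst X A (w' x) = w x) →
      ∃ k : (Fin (m + 2) → X) → A, IsEquivariant ρ k ∧ coboundary k = z := by
    intro m A _ ρ z hz dz H
    let κ : (Fin (m + 2) → X) → X → A := fun x y => z (Fin.cons y x : Fin (m + 3) → X)
    have hκ : IsEquivariant (funEnd X ρ) κ := fun g x => by
      funext y
      rw [funEnd_apply, ← hz, smul_fin_cons, smul_inv_smul]
    have dκ : coboundary κ = fun x => constHom X A (z x) := by
      funext x y
      rw [coboundary_apply_apply]
      exact congrFun (coboundary_cone dz y) x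
    obtain ⟨w', hw', dw', ew'⟩ := H (fun x => modConst X A (κ x)) (hκ.map modConst_equivariant)
      (by rw [map_coboundary, dκ]; funext x; exact modConst_constHom _)
    obtain ⟨k, hk, ek⟩ := exists_eq_constHom (hκ.sub hw')
      (fun x => by rw [Pi.sub_apply, map_sub, ew', sub_self])
    refine ⟨k, hk, ?_⟩
    have := congrArg coboundary ek
    rw [coboundary_sub, dw', sub_zero, dκ, map_coboundary] at this
    funext x
    exact (constHom_injective (congrFun this x)).symm
  induction n with
  | zero =>
    intro A _ ρ z hz dz
    refine descend hz dz fun w hw dw => ?_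
    -- Here `w` has degree 1, where it need not be a coboundary of an equivariant function. Lift its
    -- affine primitive instead, together with the crossed homomorphism.
    obtain ⟨b, β, hβ, hb, db⟩ := exists_affine_primitive hw dw
    obtain ⟨β', hβ', eβ⟩ := exists_crossedHom_lift (ρ := funEnd X ρ) modConst_equivariant
      modConst_surjective hβ
    obtain ⟨b', hb', eb⟩ := exists_equivariant_lift (X := Fin 1 → X)
      (affineEnd (funEnd X ρ) β' hβ') (affineEnd _ β hβ) (π := modConst X A) modConst_surjective
      (fun g s => by
        rw [affineEnd_apply, affineEnd_apply, map_add, eβ, modConst_equivariant])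
      (fun g x h => by rw [free' ρ g x h, map_one]) b hb
    -- The translation part `β' g` cancels in the difference of two values of `b'`, so the
    -- coboundary is equivariant for the linear action.
    refine ⟨coboundary b', fun g x => ?_, coboundary_coboundary _, fun x => ?_⟩
    · rw [← Fin.cons_self_tail x]
      rw [smul_fin_cons, coboundary_cons, coboundary_cons, coboundary_zero_apply, coboundary_zero_apply,
        hb']
      have : (Fin.cons (g • x 0) ![] : Fin 1 → X) = g • (Fin.cons (x 0) ![] : Fin 1 → X) := by
        rw [smul_fin_cons]
        exact congrArg _ (Subsingleton.elim _ _)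
      rw [this, hb', affineEnd_apply, affineEnd_apply, add_sub_add_right_eq_sub, map_sub]
    · rw [← db]
      rw [← funext eb, map_coboundary]
  | succ n ih =>
    intro A _ ρ z hz dz
    refine descend hz dz fun w hw dw => ?_
    obtain ⟨l, hl, dl⟩ := ih hw dw
    obtain ⟨l', hl', el⟩ := hl.exists_lift (ρ := funEnd X ρ) modConst_equivariant
      modConst_surjective (fun g x h => by rw [free' ρ g x h, map_one])
    refine ⟨coboundary l', hl'.coboundary, coboundary_coboundary _, fun x => ?_⟩
    rw [← dl, ← funext el, map_coboundary]

end Equivariant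

/-! ### Uniform cochains and induction from a subgroup of finite index -/

section Uniform

variable {G A B : Type*} [Group G] [AddCommGroup A] [AddCommGroup B] {n : ℕ}

/-- A function on `n`-tuples in `G` is uniform with respect to `N` if it factors through `G ⧸ N`. -/
def IsUniformMod (N : FiniteIndexNormalSubgroup G) (f : (Fin n → G) → A) : Prop :=
  ∀ x y : Fin n → G, (∀ i, (x i)⁻¹ * y i ∈ N.toSubgroup) → f x = f y

/-- A function on tuples is uniform if it factors through a finite quotient of `G`. -/
def IsUniform (f : (Fin n → G) → A) : Prop :=
  ∃ N : FiniteIndexNormalSubgroup G, IsUniformMod N f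

theorem IsUniformMod.mono {C : Type*} {N N' : FiniteIndexNormalSubgroup G} (h : N' ≤ N)
    {f : (Fin n → G) → C} (hf : IsUniformMod N f) : IsUniformMod N' f :=
  fun x y hxy => hf x y fun i => h (hxy i)

theorem IsUniform.sub {f f' : (Fin n → G) → A} (hf : IsUniform f) (hf' : IsUniform f') :
    IsUniform (f - f') := by
  obtain ⟨N, hN⟩ := hf
  obtain ⟨N', hN'⟩ := hf'
  refine ⟨N ⊓ N', fun x y h => ?_⟩
  rw [Pi.sub_apply, Pi.sub_apply, hN.mono inf_le_left x y h, hN'.mono inf_le_right x y h]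

theorem IsUniform.add {f f' : (Fin n → G) → A} (hf : IsUniform f) (hf' : IsUniform f') :
    IsUniform (f + f') := by
  obtain ⟨N, hN⟩ := hf
  obtain ⟨N', hN'⟩ := hf'
  refine ⟨N ⊓ N', fun x y h => ?_⟩
  rw [Pi.add_apply, Pi.add_apply, hN.mono inf_le_left x y h, hN'.mono inf_le_right x y h]

theorem IsUniform.coboundary {f : (Fin n → G) → A} (hf : IsUniform f) :
    IsUniform (coboundary f) := by
  obtain ⟨N, hN⟩ := hf
  refine ⟨N, fun x y h => ?_⟩
  exact Finset.sum_congr rfl fun i _ => by rw [hN _ _ fun j => h (i.succAbove j)]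

theorem IsUniform.map (φ : A →+ B) {f : (Fin n → G) → A} (hf : IsUniform f) :
    IsUniform (fun x => φ (f x)) := by
  obtain ⟨N, hN⟩ := hf
  exact ⟨N, fun x y h => congrArg φ (hN x y h)⟩

theorem IsUniform.of_map {φ : A →+ B} (inj : Function.Injective φ) {f : (Fin n → G) → A}
    (hf : IsUniform (fun x => φ (f x))) : IsUniform f := by
  obtain ⟨N, hN⟩ := hf
  exact ⟨N, fun x y h => inj (hN x y h)⟩

/-- The kernel of the action on a finite module. -/
def endKer [Finite A] (ρ : G →* AddMonoid.End A) : FiniteIndexNormalSubgroup G where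
  toSubgroup := ρ.ker
  isFiniteIndex' := by
    have : Finite (AddMonoid.End A) :=
      Finite.of_injective (fun e : AddMonoid.End A => (e : A → A)) DFunLike.coe_injective
    have h : ρ.ker = ρ.toHomUnits.ker := by
      ext g
      simp [MonoidHom.mem_ker]
    rw [h]
    exact Subgroup.finiteIndex_ker _

theorem end_eq_one [Finite A] {ρ : G →* AddMonoid.End A} {N : FiniteIndexNormalSubgroup G}
    (h : N ≤ endKer ρ) {g : G} (hg : g ∈ N.toSubgroup) : ρ g = 1 :=
  h hg

variable {ρ : G →* AddMonoid.End A} {σ : G →* AddMonoid.End B}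

/-- An equivariant function of one variable is determined by its value at `1` through the action,
and the action on a finite module factors through a finite quotient. -/
theorem IsEquivariant.isUniform_fin_one [Finite A] {f : (Fin 1 → G) → A}
    (hf : IsEquivariant ρ f) : IsUniform f := by
  refine ⟨endKer ρ, fun x y h => ?_⟩
  have key : ∀ x : Fin 1 → G, f x = ρ (x 0) (f 1) := fun x => by
    rw [← hf]
    congr 1
    funext i
    rw [Subsingleton.elim i 0]
    exact (mul_one _).symm
  have h1 : ρ ((x 0)⁻¹ * y 0) = 1 := end_eq_one le_rfl (h 0)
  rw [key x, key y, ← mul_inv_cancel_left (x 0) (y 0), map_mul ρ, h1, mul_one]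

/-- Equivariant uniform functions lift along surjections of finite modules to equivariant uniform
functions. -/
theorem IsUniform.exists_lift [Finite A] {φ : A →+ B} (hφ : ∀ g a, φ (ρ g a) = σ g (φ a))
    (surj : Function.Surjective φ) {f : (Fin (n + 1) → G) → B} (hf : IsEquivariant σ f)
    (uf : IsUniform f) :
    ∃ f' : (Fin (n + 1) → G) → A, IsEquivariant ρ f' ∧ IsUniform f' ∧ ∀ x, φ (f' x) = f x := by
  obtain ⟨N, hN⟩ := uf
  -- Shrinking `N` into the kernel of the action makes stabilizers of tuples of cosets act trivially
  -- on `A`, so the lift can be made on the finite quotient itself.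
  replace hN := hN.mono (inf_le_left : N ⊓ endKer ρ ≤ N)
  have hle : N ⊓ endKer ρ ≤ endKer ρ := inf_le_right
  generalize N ⊓ endKer ρ = N' at hN hle
  let π : (Fin (n + 1) → G) → (Fin (n + 1) → G ⧸ N'.toSubgroup) := fun x i => x i
  have hπ : ∀ (g : G) x, π (g • x) = g • π x := fun g x => rfl
  let f₁ : (Fin (n + 1) → G ⧸ N'.toSubgroup) → B := fun q => f fun i => (q i).out
  have hf₁ : ∀ x, f₁ (π x) = f x := fun x => hN _ _ fun i =>
    QuotientGroup.eq.1 (Quotient.out_eq _)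
  have surjπ : Function.Surjective π := fun q => ⟨fun i => (q i).out, funext fun i =>
    Quotient.out_eq _⟩
  have ef₁ : IsEquivariant σ f₁ := fun g q => by
    obtain ⟨x, rfl⟩ := surjπ q
    rw [← hπ, hf₁, hf₁, hf]
  obtain ⟨f', hf', e⟩ := ef₁.exists_lift hφ surj (fun g q h => by
    obtain ⟨x, rfl⟩ := surjπ q
    refine end_eq_one hle ?_
    have h0 : ((g * x 0 : G) : G ⧸ N'.toSubgroup) = x 0 := congrFun h 0
    have h1 := QuotientGroup.eq.1 h0.symm
    have := N'.isNormal'.conj_mem _ h1 (x 0)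
    simpa [mul_assoc] using this)
  refine ⟨fun x => f' (π x), fun g x => hf' g (π x), ⟨N', fun x y h => ?_⟩, fun x => ?_⟩
  · exact congrArg f' (funext fun i => QuotientGroup.eq.2 (h i))
  · rw [e, hf₁]

/-- The function with values in functions on `G ⧸ H` attached to an `H`-equivariant function. -/
noncomputable def induce (H : Subgroup G) (ρ : G →* AddMonoid.End A) (k : (Fin n → G) → A) :
    (Fin n → G) → G ⧸ H → A :=
  fun x q => ρ q.out (k (q.out⁻¹ • x))

section Induce

variable {H : Subgroup G} {k : (Fin n → G) → A}

/-- Two representatives of a coset differ by an element of `H` on the right, which the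
`H`-equivariance of `k` absorbs. -/
theorem induce_mk (hk : IsEquivariant (ρ.comp H.subtype) k) (x : Fin n → G) (y : G) :
    induce H ρ k x (y : G ⧸ H) = ρ y (k (y⁻¹ • x)) := by
  obtain ⟨h, hh⟩ := QuotientGroup.mk_out_eq_mul H y
  have := hk h ((y * h)⁻¹ • x)
  rw [MonoidHom.comp_apply, Subgroup.subtype_apply, Subgroup.smul_def, smul_smul, mul_inv_rev,
    mul_inv_cancel_left] at this
  rw [induce, hh, end_mul_apply, this, mul_inv_rev]

theorem induce_equivariant (hk : IsEquivariant (ρ.comp H.subtype) k) :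
    IsEquivariant (funEnd (G ⧸ H) ρ) (induce H ρ k) := fun g x => by
  funext q
  obtain ⟨y, rfl⟩ := QuotientGroup.mk_surjective q
  have : g⁻¹ • (y : G ⧸ H) = ((g⁻¹ * y : G) : G ⧸ H) := rfl
  rw [funEnd_apply, this, induce_mk hk, induce_mk hk, ← end_mul_apply, mul_inv_cancel_left,
    mul_inv_rev, inv_inv, mul_smul]

theorem induce_coboundary (k : (Fin n → G) → A) :
    coboundary (induce H ρ k) = induce H ρ (coboundary k) := by
  funext x q
  rw [coboundary_apply_apply]
  exact congrFun (map_coboundary (ρ q.out : A →+ A) fun z : Fin n → G => k (q.out⁻¹ • z)) x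

theorem induce_of_equivariant (hk : IsEquivariant ρ k) :
    induce H ρ k = fun x => constHom (G ⧸ H) A (k x) := by
  funext x q
  rw [induce, ← hk, smul_inv_smul, constHom_apply]

theorem induce_isUniform (hk : IsUniform k) : IsUniform (induce H ρ k) := by
  obtain ⟨N, hN⟩ := hk
  refine ⟨N, fun x y h => ?_⟩
  funext q
  refine congrArg (ρ q.out) (hN _ _ fun i => ?_)
  simpa [mul_assoc] using h i

theorem induce_add (k k' : (Fin n → G) → A) :
    induce H ρ (k + k') = induce H ρ k + induce H ρ k' := by
  funext x q
  simp [induce]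

end Induce

end Uniform

/-! ### Making cochains uniform up to coboundaries -/

/-- In an almost free group, a cochain with uniform coboundary is, over a subgroup of finite index,
the sum of a coboundary and a uniform cochain. -/
theorem exists_primitive_mod_uniform {G : Type u} [Group G] (hG : IsAlmostFree G) {n : ℕ}
    {A : Type u} [AddCommGroup A] [Finite A] {ρ : G →* AddMonoid.End A}
    {h : (Fin (n + 2) → G) → A} (hh : IsEquivariant ρ h) (uh : IsUniform (coboundary h)) :
    ∃ H : Subgroup G, H.FiniteIndex ∧ ∃ (k : (Fin (n + 1) → G) → A) (u : (Fin (n + 2) → G) → A),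
      IsEquivariant (ρ.comp H.subtype) k ∧ IsEquivariant (ρ.comp H.subtype) u ∧ IsUniform u ∧
      h = coboundary k + u := by
  obtain ⟨F, hF, hF'⟩ := hG
  obtain ⟨N₀, hN₀⟩ := uh
  -- `N` is chosen so that the coboundary of `h` factors through its quotient, `N` acts trivially on
  -- `A`, and `N` lies in `F`, hence is free by Nielsen–Schreier.
  let N : FiniteIndexNormalSubgroup G := N₀ ⊓ endKer ρ ⊓ .ofSubgroup F.normalCore
  have hNF : N.toSubgroup ≤ F := fun g hg => F.normalCore_le hg.2
  have hNρ : ∀ g ∈ N.toSubgroup, ρ g = 1 := fun g hg => end_eq_one le_rfl hg.1.2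
  have hN : IsUniformMod N (coboundary h) := hN₀.mono (inf_le_left.trans inf_le_left)
  have hNfree : IsFreeGroup N.toSubgroup :=
    IsFreeGroup.ofMulEquiv (Subgroup.subgroupOfEquivOfLe hNF)
  -- The cone from `1` of the coboundary of `h`. Moving the apex by an element of `N` does not
  -- change the uniform coboundary, so this cone is `N`-equivariant, and `h - u` is a cocycle over
  -- `N`.
  let u : (Fin (n + 2) → G) → A := fun x => coboundary h (Fin.cons 1 x : Fin (n + 3) → G)
  have uu : IsUniform u := ⟨N, fun x y hxy => hN _ _ fun i => by
    refine Fin.cases ?_ hxy i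
    simp⟩
  have eu : IsEquivariant (ρ.comp N.toSubgroup.subtype) u := fun g x => by
    have h1 : coboundary h (Fin.cons 1 ((g : G) • x) : Fin (n + 3) → G) =
        coboundary h ((g : G) • Fin.cons 1 x : Fin (n + 3) → G) := hN _ _ fun i => by
      rw [smul_fin_cons]
      refine Fin.cases ?_ (fun i => ?_) i
      · simp
      · simp
    exact h1.trans (hh.coboundary g _)
  have du : coboundary u = coboundary h := coboundary_cone (coboundary_coboundary h) 1
  have ez : IsEquivariant (ρ.comp N.toSubgroup.subtype) (h - u) :=
    .sub (fun g x => hh g x) eu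
  have dz : coboundary (h - u) = 0 := by rw [coboundary_sub, du, sub_self]
  obtain ⟨K, hK, k, ek, dk⟩ : ∃ K : Subgroup N.toSubgroup, K.FiniteIndex ∧
      ∃ k : (Fin (n + 1) → G) → A,
        IsEquivariant ((ρ.comp N.toSubgroup.subtype).comp K.subtype) k ∧ coboundary k = h - u := by
    cases n with
    | zero => exact exists_subgroup_primitive ez dz
    | succ n =>
      obtain ⟨k, ek, dk⟩ := exists_primitive_of_isFreeGroup (Γ := N.toSubgroup) (X := G)
        (fun g x hx => Subtype.ext (mul_eq_right.1 hx)) n ez dz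
      exact ⟨⊤, inferInstance, k, fun g x => ek g x, dk⟩
  refine ⟨K.map N.toSubgroup.subtype, ⟨?_⟩, k, u, ?_, ?_, uu, by rw [dk, sub_add_cancel]⟩
  · rw [Subgroup.index_map_subtype]
    exact mul_ne_zero hK.index_ne_zero N.isFiniteIndex'.index_ne_zero
  · rintro ⟨_, g, hg, rfl⟩ x
    exact ek ⟨g, hg⟩ x
  · rintro ⟨_, g, hg, rfl⟩ x
    exact eu g x

/-- Coboundaries of equivariant cochains, in degree `p`. -/
def IsCoboundary {G A : Type*} [Group G] [AddCommGroup A] (ρ : G →* AddMonoid.End A) :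
    (p : ℕ) → ((Fin (p + 1) → G) → A) → Prop
  | 0, s => s = 0
  | p + 1, s => ∃ k : (Fin (p + 1) → G) → A, IsEquivariant ρ k ∧ coboundary k = s

theorem IsCoboundary.isEquivariant {G A : Type*} [Group G] [AddCommGroup A]
    {ρ : G →* AddMonoid.End A} {p : ℕ} {s : (Fin (p + 1) → G) → A} (hs : IsCoboundary ρ p s) :
    IsEquivariant ρ s := by
  cases p with
  | zero =>
    obtain rfl : s = 0 := hs
    exact fun g x => (map_zero (ρ g)).symm
  | succ p =>
    obtain ⟨k, hk, rfl⟩ := hs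
    exact hk.coboundary

theorem IsCoboundary.coboundary_eq_zero {G A : Type*} [Group G] [AddCommGroup A]
    {ρ : G →* AddMonoid.End A} {p : ℕ} {s : (Fin (p + 1) → G) → A} (hs : IsCoboundary ρ p s) :
    coboundary s = 0 := by
  cases p with
  | zero =>
    obtain rfl : s = 0 := hs
    exact coboundary_zero
  | succ p =>
    obtain ⟨k, hk, rfl⟩ := hs
    exact coboundary_coboundary k

/-- Lift the primitive, not the coboundary: `G` acts freely on nonempty tuples, so equivariant
primitives lift, and the coboundary of the lift is automatically a cocycle. -/
theorem IsCoboundary.exists_lift {G A B : Type*} [Group G] [AddCommGroup A] [AddCommGroup B]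
    {ρ : G →* AddMonoid.End A} {σ : G →* AddMonoid.End B} {φ : A →+ B}
    (hφ : ∀ g a, φ (ρ g a) = σ g (φ a)) (surj : Function.Surjective φ) {p : ℕ}
    {s : (Fin (p + 1) → G) → B} (hs : IsCoboundary σ p s) :
    ∃ s' : (Fin (p + 1) → G) → A, IsCoboundary ρ p s' ∧ ∀ x, φ (s' x) = s x := by
  cases p with
  | zero =>
    obtain rfl : s = 0 := hs
    exact ⟨0, rfl, fun x => map_zero φ⟩
  | succ p =>
    obtain ⟨k, hk, rfl⟩ := hs
    obtain ⟨k', hk', e⟩ := hk.exists_lift hφ surj fun g x h => by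
      rw [mul_eq_right.1 (congrFun h 0 : g * x 0 = x 0), map_one]
    exact ⟨coboundary k', ⟨k', hk', rfl⟩, fun x => by rw [← funext e, map_coboundary]⟩

/-- In an almost free group, a cochain with uniform coboundary is uniform up to coboundaries. -/
theorem exists_coboundary_isUniform_sub {G : Type u} [Group G] (hG : IsAlmostFree G) (p : ℕ) :
    ∀ {A : Type u} [AddCommGroup A] [Finite A] {ρ : G →* AddMonoid.End A}
      {h : (Fin (p + 1) → G) → A}, IsEquivariant ρ h → IsUniform (coboundary h) →
      ∃ s, IsCoboundary ρ p s ∧ IsUniform (h - s) := by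
  induction p with
  | zero =>
    intro A _ _ ρ h hh _
    exact ⟨0, rfl, by simpa using hh.isUniform_fin_one⟩
  | succ p ih =>
    intro A _ _ ρ h hh uh
    obtain ⟨H, hH, k, u, hk, hu, uu, e⟩ := exists_primitive_mod_uniform hG hh uh
    have : Finite (G ⧸ H) := H.finite_quotient_of_finiteIndex
    have : Finite (FunModConst (G ⧸ H) A) := Finite.of_surjective _ modConst_surjective
    let κ := induce H ρ k
    have hκ : IsEquivariant (funEnd (G ⧸ H) ρ) κ := induce_equivariant hk
    have eκ : (fun x => constHom (G ⧸ H) A (h x)) = coboundary κ + induce H ρ u := by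
      rw [← induce_of_equivariant hh, induce_coboundary, ← induce_add, ← e]
    -- By `eκ` the coboundary of `κ` is minus the induced `u` modulo the constants given by `h`.
    have uκ : IsUniform (coboundary fun x => modConst (G ⧸ H) A (κ x)) := by
      have h1 : (coboundary fun x => modConst (G ⧸ H) A (κ x)) =
          fun x => modConst (G ⧸ H) A ((0 - induce H ρ u) x) := by
        rw [map_coboundary, zero_sub]
        funext x
        have := congrArg (modConst (G ⧸ H) A) (congrFun eκ x)
        rw [modConst_constHom, Pi.add_apply, map_add] at this
        rw [Pi.neg_apply, map_neg]
        exact eq_neg_of_add_eq_zero_left this.symm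
      rw [h1]
      exact IsUniform.map _ (.sub ⟨endKer ρ, fun _ _ _ => rfl⟩ (induce_isUniform uu))
    obtain ⟨s, hs, us⟩ := ih (hκ.map modConst_equivariant) uκ
    obtain ⟨s', hs', es⟩ := hs.exists_lift (ρ := funEnd (G ⧸ H) ρ) modConst_equivariant
      modConst_surjective
    obtain ⟨v, hv, uv, ev⟩ := us.exists_lift (ρ := funEnd (G ⧸ H) ρ) modConst_equivariant
      modConst_surjective ((hκ.map modConst_equivariant).sub hs.isEquivariant)
    -- `s'` and `v` lift the coboundary part and the uniform part of `κ` modulo constants, so what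
    -- remains of `κ` is constant-valued. Since `s'` is a cocycle, `h` minus the coboundary of `w`
    -- involves only `v` and the induced `u`.
    obtain ⟨w, hw, ew⟩ := exists_eq_constHom ((hκ.sub hs'.isEquivariant).sub hv) fun x => by
      rw [Pi.sub_apply, Pi.sub_apply, map_sub, map_sub, es, ev, Pi.sub_apply]
      abel
    refine ⟨coboundary w, ⟨w, hw, rfl⟩, ?_⟩
    refine IsUniform.of_map (φ := constHom (G ⧸ H) A) constHom_injective ?_
    have h2 : (fun x => constHom (G ⧸ H) A ((h - coboundary w) x)) =
        coboundary v + induce H ρ u := by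
      have h3 := congrArg coboundary ew
      rw [coboundary_sub, coboundary_sub, hs'.coboundary_eq_zero, sub_zero, map_coboundary] at h3
      funext x
      rw [Pi.sub_apply, map_sub, ← congrFun h3 x, congrFun eκ x]
      simp only [Pi.add_apply, Pi.sub_apply]
      abel
    rw [h2]
    exact uv.coboundary.add (induce_isUniform uu)

open TopRep

/-! ### Homology of short complexes of topological modules, in terms of elements -/

section Homology

variable {R : Type*} [Ring R] [TopologicalSpace R]

/-- The left homology data of a short complex of topological modules given by the kernel and the
quotient. -/
def topLeftHomologyData (S : ShortComplex (TopModuleCat.{u} R)) : S.LeftHomologyData :=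
  ⟨_, _, _, _, _, TopModuleCat.isLimitKer _, by simp, TopModuleCat.isColimitCoker _⟩

theorem exists_cycle (S : ShortComplex (TopModuleCat.{u} R)) (x : S.X₂) (hx : S.g x = 0) :
    ∃ z : S.cycles, S.iCycles z = x := by
  let D := topLeftHomologyData S
  refine ⟨D.cyclesIso.inv ⟨x, hx⟩, ?_⟩
  exact ConcreteCategory.congr_hom D.cyclesIso_inv_comp_iCycles ⟨x, hx⟩

theorem homologyIso_homologyπ {S : ShortComplex (TopModuleCat.{u} R)} (D : S.LeftHomologyData)
    (z : S.cycles) : D.homologyIso.hom (S.homologyπ z) = D.π (D.cyclesIso.hom z) :=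
  ConcreteCategory.congr_hom D.homologyπ_comp_homologyIso_hom z

theorem topIso_hom_injective {M N : TopModuleCat.{u} R} (e : M ≅ N) :
    Function.Injective e.hom := fun a b h => by
  have := congrArg e.inv h
  simpa using this

theorem homologyπ_surjective (S : ShortComplex (TopModuleCat.{u} R)) :
    Function.Surjective S.homologyπ := by
  let D := topLeftHomologyData S
  intro y
  obtain ⟨z, hz⟩ := TopModuleCat.cokerπ_surjective D.f' (D.homologyIso.hom y)
  refine ⟨D.cyclesIso.inv z, topIso_hom_injective D.homologyIso ?_⟩
  rw [homologyIso_homologyπ, ← hz]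
  exact congrArg D.π (ConcreteCategory.congr_hom D.cyclesIso.inv_hom_id z)

/-- The cokernel used here is the quotient by the image itself, not by its closure, so topology
plays no role in deciding which classes vanish. -/
theorem homologyπ_eq_zero (S : ShortComplex (TopModuleCat.{u} R)) (z : S.cycles) :
    S.homologyπ z = 0 ↔ ∃ y, S.f y = S.iCycles z := by
  let D := topLeftHomologyData S
  have h : S.iCycles z = D.i (D.cyclesIso.hom z) :=
    (ConcreteCategory.congr_hom D.cyclesIso_hom_comp_i z).symm
  have hf : ∀ y, S.f y = D.i (D.f' y) := fun y => (ConcreteCategory.congr_hom D.f'_i y).symm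
  have h1 : S.homologyπ z = 0 ↔ D.π (D.cyclesIso.hom z) = 0 := by
    rw [← homologyIso_homologyπ, ← (topIso_hom_injective D.homologyIso).eq_iff, map_zero]
  have h2 : D.π (D.cyclesIso.hom z) = 0 ↔ ∃ y, D.f' y = D.cyclesIso.hom z :=
    (Submodule.Quotient.mk_eq_zero _).trans LinearMap.mem_range
  rw [h1, h2]
  refine exists_congr fun y => ?_
  rw [h, hf]
  exact Subtype.ext_iff

/-- A criterion in terms of elements for a map of short complexes to be bijective on homology. -/
theorem homologyMap_bijective {S T : ShortComplex (TopModuleCat.{u} R)} (φ : S ⟶ T)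
    (surj : ∀ x, T.g x = 0 → ∃ y, S.g y = 0 ∧ ∃ w, T.f w = x - φ.τ₂ y)
    (inj : ∀ y, S.g y = 0 → (∃ w, T.f w = φ.τ₂ y) → ∃ w, S.f w = y) :
    Function.Bijective (ShortComplex.homologyMap φ) := by
  have h1 : ∀ z, ShortComplex.homologyMap φ (S.homologyπ z) =
      T.homologyπ (ShortComplex.cyclesMap φ z) := fun z =>
    ConcreteCategory.congr_hom (ShortComplex.homologyπ_naturality φ) z
  have h2 : ∀ z, T.iCycles (ShortComplex.cyclesMap φ z) = φ.τ₂ (S.iCycles z) := fun z =>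
    ConcreteCategory.congr_hom (ShortComplex.cyclesMap_i φ) z
  constructor
  · refine (injective_iff_map_eq_zero _).2 fun a ha => ?_
    obtain ⟨z, rfl⟩ := homologyπ_surjective S a
    rw [h1, homologyπ_eq_zero, h2] at ha
    exact (homologyπ_eq_zero S z).2
      (inj _ (ConcreteCategory.congr_hom S.iCycles_g z) ha)
  · intro b
    obtain ⟨z, rfl⟩ := homologyπ_surjective T b
    obtain ⟨y, hy, w, hw⟩ := surj _ (ConcreteCategory.congr_hom T.iCycles_g z)
    obtain ⟨y', rfl⟩ := exists_cycle S y hy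
    refine ⟨S.homologyπ y', ?_⟩
    rw [h1, eq_comm, ← sub_eq_zero, ← map_sub, homologyπ_eq_zero]
    exact ⟨w, by rw [hw, map_sub, h2]; rfl⟩

theorem sc_g_eq_zero_iff (K : CochainComplex (TopModuleCat.{u} R) ℕ) (p : ℕ) (x : K.X p) :
    (K.sc p).g x = 0 ↔ K.d p (p + 1) x = 0 := by
  have h : ∀ j, j = p + 1 → (K.d p j x = 0 ↔ K.d p (p + 1) x = 0) := by
    rintro _ rfl
    rfl
  exact h _ (CochainComplex.next ℕ p)

/-- No differential enters degree 0. This is why `IsCoboundary` means vanishing there. -/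
theorem exists_sc_zero_f_eq_iff (K : CochainComplex (TopModuleCat.{u} R) ℕ) (y : K.X 0) :
    (∃ w, (K.sc 0).f w = y) ↔ y = 0 := by
  have h : (K.sc 0).f = 0 := K.shape _ _ (by simp)
  rw [h]
  exact ⟨fun ⟨w, hw⟩ => hw.symm, fun hy => ⟨0, hy.symm⟩⟩

theorem exists_sc_succ_f_eq_iff (K : CochainComplex (TopModuleCat.{u} R) ℕ) (p : ℕ)
    (y : K.X (p + 1)) : (∃ w, (K.sc (p + 1)).f w = y) ↔ ∃ w : K.X p, K.d p (p + 1) w = y := by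
  have h : ∀ i, i = p → ((∃ w : K.X i, K.d i (p + 1) w = y) ↔
      ∃ w : K.X p, K.d p (p + 1) w = y) := by
    rintro _ rfl
    rfl
  exact h _ (CochainComplex.prev_nat_succ p)

end Homology

/-! ### Iterated continuous functions as functions of several variables -/

section Evaluation

variable {k : Type*} [Ring k] [TopologicalSpace k] {Γ : Type u} [Group Γ] [TopologicalSpace Γ]
  [IsTopologicalGroup Γ] (X : TopRep.{u} k Γ)

/-- The function of several variables underlying an iterated continuous function. -/
def evalCochain : (n : ℕ) → resolutionX X n → (Fin n → Γ) → X
  | 0, m, _ => m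
  | n + 1, f, x => evalCochain n ((f : C(Γ, resolutionX X n)) (x 0)) (Fin.tail x)

theorem evalCochain_succ_apply (n : ℕ) (f : C(Γ, resolutionX X n)) (x : Fin (n + 1) → Γ) :
    evalCochain X (n + 1) f x = evalCochain X n (f (x 0)) (Fin.tail x) := rfl

theorem evalCochain_sub (n : ℕ) (f f' : resolutionX X n) :
    evalCochain X n (f - f') = evalCochain X n f - evalCochain X n f' := by
  induction n with
  | zero => rfl
  | succ n ih =>
    funext x
    exact congrFun (ih _ _) _

theorem evalCochain_zero (n : ℕ) : evalCochain X n 0 = 0 := by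
  have := evalCochain_sub X n 0 0
  rwa [sub_self, sub_self] at this

theorem evalCochain_injective (n : ℕ) : Function.Injective (evalCochain X n) := by
  induction n with
  | zero => exact fun f f' h => congrFun h ![]
  | succ n ih =>
    intro f f' h
    refine ContinuousMap.ext fun g => ih (funext fun x => ?_)
    have := congrFun h (Fin.cons g x)
    exact this

theorem evalCochain_surjective [DiscreteTopology Γ] (n : ℕ) :
    Function.Surjective (evalCochain X n) := by
  induction n with
  | zero => exact fun f => ⟨f ![], funext fun x => congrArg f (Subsingleton.elim _ _)⟩
  | succ n ih =>
    intro f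
    choose s hs using ih
    refine ⟨(⟨fun g => s fun x => f (Fin.cons g x), continuous_of_discreteTopology⟩ :
      C(Γ, resolutionX X n)), funext fun x => ?_⟩
    rw [evalCochain_succ_apply, ContinuousMap.coe_mk, hs, Fin.cons_self_tail]

theorem evalCochain_d (n : ℕ) (f : resolutionX X n) :
    evalCochain X (n + 1) ((d X n).hom f) = coboundary (evalCochain X n f) := by
  induction n with
  | zero =>
    funext x
    rw [coboundary_zero_apply]
    rfl
  | succ n ih =>
    funext x
    have h1 : evalCochain X (n + 2) ((d X (n + 1)).hom f) x =
        evalCochain X (n + 1) (f - (d X n).hom ((f : C(Γ, resolutionX X n)) (x 0)))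
          (Fin.tail x) := rfl
    have h2 := coboundary_cons (evalCochain X (n + 1) f) (x 0) (Fin.tail x)
    rw [Fin.cons_self_tail] at h2
    rw [h1, h2, evalCochain_sub, ih]
    rfl

theorem evalCochain_ρ (n : ℕ) (g : Γ) (f : resolutionX X n) (x : Fin n → Γ) :
    evalCochain X n ((resolutionX X n).ρ g f) x = X.ρ g (evalCochain X n f (g⁻¹ • x)) := by
  induction n with
  | zero => rfl
  | succ n ih => exact ih _ _

theorem evalCochain_resolutionMap {Δ : Type u} [Group Δ] [TopologicalSpace Δ]
    [IsTopologicalGroup Δ] {Y : TopRep.{u} k Δ} (φ : Δ →ₜ* Γ)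
    (f : res (φ : Δ →* Γ) X ⟶ Y) (n : ℕ) (c : resolutionX X n) (x : Fin n → Δ) :
    evalCochain Y n ((ContinuousCohomology.resolutionMap φ f n).hom c) x =
      f.hom (evalCochain X n c fun i => φ (x i)) := by
  induction n with
  | zero => rfl
  | succ n ih => exact ih _ _

/-- The cochain underlying an invariant cochain. -/
def invariantVal {n : ℕ} (σ : (resolutionX X n).invariants) : resolutionX X n := σ.1

variable {X}

theorem invariantVal_injective {n : ℕ} : Function.Injective (invariantVal X (n := n)) :=
  Subtype.val_injective

theorem ρ_invariantVal {n : ℕ} (g : Γ) (σ : (resolutionX X n).invariants) :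
    (resolutionX X n).ρ g (invariantVal X σ) = invariantVal X σ := σ.2 g

theorem exists_invariantVal_eq {n : ℕ} {c : resolutionX X n}
    (hc : ∀ g, (resolutionX X n).ρ g c = c) : ∃ σ, invariantVal X σ = c :=
  ⟨⟨c, hc⟩, rfl⟩

theorem invariantVal_sub {n : ℕ} (σ τ : (resolutionX X n).invariants) :
    invariantVal X (σ - τ) = invariantVal X σ - invariantVal X τ := rfl

theorem invariantVal_zero {n : ℕ} : invariantVal X (0 : (resolutionX X n).invariants) = 0 := rfl

theorem homogeneousCochains_d_eq_iff {p : ℕ} (σ : (resolutionX X (p + 1)).invariants)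
    (τ : (resolutionX X (p + 2)).invariants) :
    (homogeneousCochains X).d p (p + 1) σ = τ ↔
      (d X (p + 1)).hom (invariantVal X σ) = invariantVal X τ := by
  rw [homogeneousCochains.d_eq]
  exact Subtype.ext_iff

end Evaluation

/-! ### Topology of the profinite completion -/

section Completion

variable {G : Type u} [Group G]

/-- The projection of the completion to a finite quotient. -/
def completionProj (N : FiniteIndexNormalSubgroup G) : Completion G →* G ⧸ N.toSubgroup where
  toFun x := x.1 N
  map_one' := rfl
  map_mul' _ _ := rfl

theorem completionProj_mono {N N' : FiniteIndexNormalSubgroup G} (h : N ≤ N') {x y : Completion G}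
    (hxy : completionProj N x = completionProj N y) :
    completionProj N' x = completionProj N' y := by
  have hx := x.2 h.hom
  have hy := y.2 h.hom
  change x.1 N' = y.1 N'
  rw [← hx, ← hy]
  exact congrArg _ hxy

theorem isOpen_completionProj_eq (N : FiniteIndexNormalSubgroup G) (x : Completion G) :
    IsOpen {y : Completion G | completionProj N y = completionProj N x} := by
  have h : Continuous fun x : Completion G => x.1 N :=
    (continuous_apply N).comp continuous_subtype_val
  have : DiscreteTopology ((ProfiniteGrp.ProfiniteCompletion.diagram (GrpCat.of G)).obj N) := ⟨rfl⟩
  exact (isOpen_discrete {x.1 N}).preimage h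

/-- A basic open set of the product constrains finitely many coordinates, and a single finite
quotient dominates all of them. -/
theorem exists_completionProj_subset {U : Set (Completion G)} (hU : IsOpen U) {x : Completion G}
    (hx : x ∈ U) : ∃ N : FiniteIndexNormalSubgroup G,
      ∀ y, completionProj N y = completionProj N x → y ∈ U := by
  obtain ⟨s, hs, rfl⟩ := hU
  obtain ⟨J, t, hJ, hJs⟩ := isOpen_pi_iff.mp hs _ hx
  have : Nonempty (FiniteIndexNormalSubgroup (GrpCat.of G)) := ⟨.ofSubgroup ⊤⟩
  obtain ⟨N, hN⟩ := Finite.exists_ge (fun j : J => (j : FiniteIndexNormalSubgroup G))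
  refine ⟨N, fun y hy => hJs fun j hj => ?_⟩
  have : y.1 j = x.1 j := completionProj_mono (hN ⟨j, hj⟩) hy
  rw [this]
  exact (hJ j hj).2

/-- A continuous function from the completion to a discrete space factors through a finite
quotient. -/
theorem exists_completionProj_factor {D : Type*} [TopologicalSpace D] [DiscreteTopology D]
    {f : Completion G → D} (hf : Continuous f) : ∃ N : FiniteIndexNormalSubgroup G,
      ∀ x y, completionProj N x = completionProj N y → f x = f y := by
  -- `U N` is the set of points on whose fibre over `G ⧸ N` the function is constant. These sets are
  -- open, directed and cover, so compactness gives one `N` for all points.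
  let U : FiniteIndexNormalSubgroup G → Set (Completion G) := fun N =>
    {x | ∀ y, completionProj N y = completionProj N x → f y = f x}
  have hU : ∀ N, IsOpen (U N) := fun N => by
    refine isOpen_iff_forall_mem_open.2 fun x hx =>
      ⟨_, fun y hy z hz => ?_, isOpen_completionProj_eq N x, rfl⟩
    rw [hx y hy, hx z (hz.trans hy)]
  have hmono : ∀ {N N'}, N' ≤ N → U N ⊆ U N' := fun h x hx y hy =>
    hx y (completionProj_mono h hy)
  have : Nonempty (FiniteIndexNormalSubgroup G) := ⟨.ofSubgroup ⊤⟩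
  obtain ⟨N, hN⟩ := isCompact_univ.elim_directed_cover U hU (fun x _ => by
    obtain ⟨N, hN⟩ := exists_completionProj_subset ((isOpen_discrete {f x}).preimage hf)
      (x := x) rfl
    exact Set.mem_iUnion.2 ⟨N, hN⟩)
    (fun N N' => ⟨N ⊓ N', hmono inf_le_left, hmono inf_le_right⟩)
  exact ⟨N, fun x y h => hN (Set.mem_univ y) x h⟩

/-- A continuous map to a discrete space has finite range and compact fibres, so finitely many
compact-open conditions isolate it. Hence iterated function spaces on the completion stay discrete,
and factorization applies one variable at a time. -/
theorem discreteTopology_continuousMap {X Y : Type*} [TopologicalSpace X] [CompactSpace X]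
    [TopologicalSpace Y] [DiscreteTopology Y] : DiscreteTopology C(X, Y) := by
  refine discreteTopology_iff_isOpen_singleton.2 fun f => ?_
  have hfin : (Set.range f).Finite := (isCompact_range f.continuous).finite_of_discrete
  have : {f} = ⋂ y ∈ Set.range f, {g : C(X, Y) | Set.MapsTo g (f ⁻¹' {y}) {y}} := by
    ext g
    simp only [Set.mem_singleton_iff, Set.mem_iInter, Set.mem_ofPred_eq]
    exact ⟨fun h y _ x hx => h ▸ hx, fun h => ContinuousMap.ext fun x => h _ ⟨x, rfl⟩ rfl⟩
  rw [this]
  refine hfin.isOpen_biInter fun y _ => ContinuousMap.isOpen_setOfPred_mapsTo ?_ (isOpen_discrete _)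
  exact ((isClosed_discrete {y}).preimage f.continuous).isCompact

end Completion

/-! ### Cochains of the discrete group -/

section GroupRep

variable (G : Type u) [Group G] [TopologicalSpace G] [DiscreteTopology G]
  (M : Type u) [AddCommGroup M] [TopologicalSpace M] [DiscreteTopology M] [DistribMulAction G M]

theorem evalCochain_equivariant {n : ℕ} (σ : (resolutionX (groupRep G M) n).invariants) :
    IsEquivariant (DistribMulAction.toAddMonoidEnd G M)
      (evalCochain (groupRep G M) n (invariantVal _ σ)) := fun g x => by
  have h := congrFun (congrArg (evalCochain (groupRep G M) n) (ρ_invariantVal g σ)) (g • x)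
  rw [evalCochain_ρ, inv_smul_smul] at h
  exact h.symm

theorem exists_invariant_evalCochain_eq {n : ℕ} {f : (Fin n → G) → M}
    (hf : IsEquivariant (DistribMulAction.toAddMonoidEnd G M) f) :
    ∃ σ : (resolutionX (groupRep G M) n).invariants,
      evalCochain (groupRep G M) n (invariantVal _ σ) = f := by
  obtain ⟨c, rfl⟩ := evalCochain_surjective (groupRep G M) n f
  suffices hinv : ∀ g, (resolutionX (groupRep G M) n).ρ g c = c by
    obtain ⟨σ, rfl⟩ := exists_invariantVal_eq hinv
    exact ⟨σ, rfl⟩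
  refine fun g => evalCochain_injective _ n (funext fun x => ?_)
  rw [evalCochain_ρ]
  have := hf g (g⁻¹ • x)
  rw [smul_inv_smul] at this
  exact this.symm

theorem homogeneousCochains_groupRep_d_eq_iff (p : ℕ)
    (σ : (resolutionX (groupRep G M) (p + 1)).invariants)
    (τ : (resolutionX (groupRep G M) (p + 2)).invariants) :
    (homogeneousCochains (groupRep G M)).d p (p + 1) σ = τ ↔
      coboundary (evalCochain (groupRep G M) (p + 1) (invariantVal _ σ)) =
        evalCochain (groupRep G M) (p + 2) (invariantVal _ τ) := by
  rw [homogeneousCochains_d_eq_iff, ← evalCochain_d, (evalCochain_injective _ _).eq_iff]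

end GroupRep

/-! ### Cochains of the completion -/

section CompletionRep

variable (G : Type u) [Group G] (M : Type u) [AddCommGroup M] [TopologicalSpace M]
  [DiscreteTopology M] [Finite M] [DistribMulAction G M]

theorem discreteTopology_resolutionX (n : ℕ) :
    DiscreteTopology (resolutionX (completionRep G M) n) := by
  induction n with
  | zero => assumption
  | succ n ih => exact discreteTopology_continuousMap

/-- Functions on finite quotients come from iterated continuous functions on the completion. -/
theorem exists_evalCochain_eq (N : FiniteIndexNormalSubgroup G) (n : ℕ)
    (F : (Fin n → G ⧸ N.toSubgroup) → M) :
    ∃ c, ∀ x, evalCochain (completionRep G M) n c x = F fun i => completionProj N (x i) := by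
  induction n with
  | zero => exact ⟨F ![], fun x => congrArg F (Subsingleton.elim _ _)⟩
  | succ n ih =>
    choose c hc using fun q : G ⧸ N.toSubgroup => ih fun z => F (Fin.cons q z)
    refine ⟨(⟨fun z => c (completionProj N z), ?_⟩ :
      C(Completion G, resolutionX (completionRep G M) n)), fun x => ?_⟩
    · refine IsLocallyConstant.continuous ((IsLocallyConstant.iff_exists_open _).2 fun x => ?_)
      exact ⟨_, isOpen_completionProj_eq N x, rfl, fun y hy => congrArg c hy⟩
    · rw [evalCochain_succ_apply, ContinuousMap.coe_mk, hc]
      congr 1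
      funext i
      exact Fin.cases rfl (fun _ => rfl) i

end CompletionRep

/-! ### Comparison of the two cochain complexes -/

section Restriction

variable (G : Type u) [Group G] [TopologicalSpace G] [DiscreteTopology G]
  (M : Type u) [AddCommGroup M] [TopologicalSpace M] [DiscreteTopology M] [Finite M]
  [DistribMulAction G M]

/-- Iterated continuous functions on the completion factor through a finite quotient. -/
theorem exists_evalCochain_factor (n : ℕ) (c : resolutionX (completionRep G M) n) :
    ∃ N : FiniteIndexNormalSubgroup G, ∀ x y : Fin n → Completion G,
      (∀ i, completionProj N (x i) = completionProj N (y i)) →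
      evalCochain (completionRep G M) n c x = evalCochain (completionRep G M) n c y := by
  induction n with
  | zero => exact ⟨.ofSubgroup ⊤, fun _ _ _ => rfl⟩
  | succ n ih =>
    have := discreteTopology_resolutionX G M n
    obtain ⟨N, hN⟩ := exists_completionProj_factor
      (c : C(Completion G, resolutionX (completionRep G M) n)).continuous
    choose N' hN' using ih
    have : Nonempty (FiniteIndexNormalSubgroup G) := ⟨N⟩
    -- Once the first variable factors through `G ⧸ N`, only finitely many partial functions occur,
    -- and one `P` serves all of them.
    obtain ⟨P, hP⟩ := Finite.exists_ge fun q : G ⧸ N.toSubgroup =>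
      N' ((c : C(Completion G, resolutionX (completionRep G M) n)) (toCompletion G q.out))
    refine ⟨N ⊓ P, fun x y h => ?_⟩
    rw [evalCochain_succ_apply, evalCochain_succ_apply]
    have key : ∀ z : Completion G, (c : C(Completion G, resolutionX (completionRep G M) n)) z =
        (c : C(Completion G, resolutionX (completionRep G M) n))
          (toCompletion G (completionProj N z).out) := fun z =>
      hN _ _ (Quotient.out_eq (completionProj N z)).symm
    have e : completionProj N (x 0) = completionProj N (y 0) :=
      completionProj_mono inf_le_left (h 0)
    rw [key (x 0), key (y 0), e]
    exact hN' _ _ _ fun i => completionProj_mono (inf_le_right.trans (hP _)) (h i.succ)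

/-- The cochain on `G` underlying a cochain on the completion. -/
def restrictCochain (n : ℕ) (c : resolutionX (completionRep G M) n) : (Fin n → G) → M :=
  fun x => evalCochain (completionRep G M) n c fun i => toCompletion G (x i)

/-- Both cochains factor through a common finite quotient, where every class is represented by an
element of `G`. -/
theorem restrictCochain_injective (n : ℕ) : Function.Injective (restrictCochain G M n) := by
  intro c c' h
  obtain ⟨N, hN⟩ := exists_evalCochain_factor G M n c
  obtain ⟨N', hN'⟩ := exists_evalCochain_factor G M n c'
  refine evalCochain_injective _ n (funext fun x => ?_)
  let y : Fin n → G := fun i => (completionProj (N ⊓ N') (x i)).out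
  have hy : ∀ i, completionProj (N ⊓ N') (x i) = completionProj (N ⊓ N') (toCompletion G (y i)) :=
    fun i => (Quotient.out_eq (completionProj (N ⊓ N') (x i))).symm
  rw [hN _ _ fun i => completionProj_mono inf_le_left (hy i),
    hN' _ _ fun i => completionProj_mono inf_le_right (hy i)]
  exact congrFun h y

theorem restrictCochain_isUniform (n : ℕ) (c : resolutionX (completionRep G M) n) :
    IsUniform (restrictCochain G M n c) := by
  obtain ⟨N, hN⟩ := exists_evalCochain_factor G M n c
  exact ⟨N, fun x y h => hN _ _ fun i => QuotientGroup.eq.2 (h i)⟩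

theorem restrictCochain_d (n : ℕ) (c : resolutionX (completionRep G M) n) :
    restrictCochain G M (n + 1) ((d (completionRep G M) n).hom c) =
      coboundary (restrictCochain G M n c) := by
  funext x
  rw [restrictCochain, evalCochain_d]
  rfl

/-- Equivariant uniform functions are the invariant cochains on the completion. -/
theorem exists_invariant_restrictCochain_eq {n : ℕ} {f : (Fin n → G) → M}
    (hf : IsEquivariant (DistribMulAction.toAddMonoidEnd G M) f) (uf : IsUniform f) :
    ∃ c : (resolutionX (completionRep G M) n).invariants,
      restrictCochain G M n (invariantVal _ c) = f := by
  obtain ⟨N, hN⟩ := uf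
  -- Inside the kernel of the action, a point of the completion and an element of `G` with the same
  -- class act alike on `M`. Invariance under the completion then follows from equivariance under
  -- `G`.
  replace hN := hN.mono (inf_le_left : N ⊓ actionKernel G M ≤ N)
  have hle : N ⊓ actionKernel G M ≤ actionKernel G M := inf_le_right
  generalize N ⊓ actionKernel G M = N' at hN hle
  obtain ⟨c, hc⟩ := exists_evalCochain_eq G M N' n fun q => f fun i => (q i).out
  have hc' : ∀ (x : Fin n → Completion G) (y : Fin n → G),
      (∀ i, completionProj N' (x i) = (y i : G ⧸ N'.toSubgroup)) →
      evalCochain (completionRep G M) n c x = f y := fun x y h => by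
    rw [hc]
    refine hN _ _ fun i => QuotientGroup.eq.1 ?_
    rw [← h i]
    exact Quotient.out_eq _
  suffices hinv : ∀ γ, (resolutionX (completionRep G M) n).ρ γ c = c by
    obtain ⟨σ, rfl⟩ := exists_invariantVal_eq hinv
    exact ⟨σ, funext fun y => hc' (fun i => toCompletion G (y i)) y fun i => rfl⟩
  refine fun γ => evalCochain_injective _ n (funext fun x => ?_)
  obtain ⟨g, hg⟩ := QuotientGroup.mk_surjective (completionProj N' γ)
  choose y hy using fun i => QuotientGroup.mk_surjective (completionProj N' (x i))
  rw [evalCochain_ρ, hc' x y fun i => (hy i).symm, hc' (γ⁻¹ • x) (g⁻¹ • y)]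
  · have h1 : completionProj (actionKernel G M) γ =
        completionProj (actionKernel G M) (toCompletion G g) :=
      completionProj_mono hle hg.symm
    have h2 : completionAction G M γ = DistribMulAction.toAddMonoidEnd G M g :=
      congrArg (quotientAction G M) h1
    have h3 : f (g • g⁻¹ • y) = completionAction G M γ (f (g⁻¹ • y)) := by
      rw [hf, h2]
    rw [smul_inv_smul] at h3
    exact h3.symm
  · intro i
    change completionProj N' (γ⁻¹ * x i) = ((g⁻¹ * y i : G) : G ⧸ N'.toSubgroup)
    rw [map_mul, map_inv, ← hg, ← hy]
    rfl

/-- The restriction map on invariant cochains. -/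
def restrictInvariants (p : ℕ) (c : (resolutionX (completionRep G M) (p + 1)).invariants) :
    (resolutionX (groupRep G M) (p + 1)).invariants :=
  (ContinuousCohomology.cochainsMap (toCompletion G) (resToGroupRep G M)).f p c

theorem evalCochain_restrictInvariants (p : ℕ)
    (c : (resolutionX (completionRep G M) (p + 1)).invariants) :
    evalCochain (groupRep G M) (p + 1) (invariantVal _ (restrictInvariants G M p c)) =
      restrictCochain G M (p + 1) (invariantVal _ c) :=
  funext fun x => evalCochain_resolutionMap (completionRep G M) (toCompletion G)
    (resToGroupRep G M) (p + 1) (invariantVal _ c) x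

theorem homogeneousCochains_completionRep_d_eq_iff (p : ℕ)
    (σ : (resolutionX (completionRep G M) (p + 1)).invariants)
    (τ : (resolutionX (completionRep G M) (p + 2)).invariants) :
    (homogeneousCochains (completionRep G M)).d p (p + 1) σ = τ ↔
      coboundary (restrictCochain G M (p + 1) (invariantVal _ σ)) =
        restrictCochain G M (p + 2) (invariantVal _ τ) := by
  rw [homogeneousCochains_d_eq_iff, ← restrictCochain_d, (restrictCochain_injective G M _).eq_iff]

theorem restrictCochain_zero (n : ℕ) : restrictCochain G M n 0 = 0 := by
  funext x
  rw [restrictCochain, evalCochain_zero]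
  rfl

/-- Cocycles on an almost free group come from the completion, up to coboundaries. -/
theorem exists_cocycle_of_isAlmostFree (hG : IsAlmostFree G) (p : ℕ)
    (x : (resolutionX (groupRep G M) (p + 1)).invariants)
    (hx : (homogeneousCochains (groupRep G M)).d p (p + 1) x = 0) :
    ∃ y : (resolutionX (completionRep G M) (p + 1)).invariants,
      (homogeneousCochains (completionRep G M)).d p (p + 1) y = 0 ∧
      ∃ w, ((homogeneousCochains (groupRep G M)).sc p).f w = x - restrictInvariants G M p y := by
  have dx : coboundary (evalCochain (groupRep G M) (p + 1) (invariantVal _ x)) = 0 := by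
    rw [(homogeneousCochains_groupRep_d_eq_iff G M p x 0).1 hx, invariantVal_zero,
      evalCochain_zero]
  obtain ⟨s, hs, us⟩ := exists_coboundary_isUniform_sub hG p (evalCochain_equivariant G M x)
    (dx ▸ ⟨actionKernel G M, fun _ _ _ => rfl⟩)
  obtain ⟨c, hc⟩ := exists_invariant_restrictCochain_eq G M
    ((evalCochain_equivariant G M x).sub hs.isEquivariant) us
  refine ⟨c, (homogeneousCochains_completionRep_d_eq_iff G M p c 0).2 ?_, ?_⟩
  · rw [hc, coboundary_sub, dx, hs.coboundary_eq_zero, sub_zero, invariantVal_zero,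
      restrictCochain_zero]
  · have key : evalCochain (groupRep G M) (p + 1)
        (invariantVal _ (x - restrictInvariants G M p c)) = s := by
      rw [invariantVal_sub, evalCochain_sub, evalCochain_restrictInvariants, hc, sub_sub_cancel]
    generalize x - restrictInvariants G M p c = v at key
    cases p with
    | zero =>
      obtain rfl : s = 0 := hs
      refine (exists_sc_zero_f_eq_iff _ _).2 (invariantVal_injective (evalCochain_injective _ _ ?_))
      exact key.trans (evalCochain_zero (groupRep G M) 1).symm
    | succ p =>
      obtain ⟨k, hk, rfl⟩ := hs
      obtain ⟨w, rfl⟩ := exists_invariant_evalCochain_eq G M hk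
      exact (exists_sc_succ_f_eq_iff _ _ _).2
        ⟨w, (homogeneousCochains_groupRep_d_eq_iff G M p w v).2 key.symm⟩

/-- A cochain on the completion of an almost free group is a coboundary if its restriction is. -/
theorem exists_primitive_of_isAlmostFree (hG : IsAlmostFree G) (p : ℕ)
    (y : (resolutionX (completionRep G M) (p + 1)).invariants)
    (hy : ∃ w, ((homogeneousCochains (groupRep G M)).sc p).f w = restrictInvariants G M p y) :
    ∃ w, ((homogeneousCochains (completionRep G M)).sc p).f w = y := by
  cases p with
  | zero =>
    have h := (exists_sc_zero_f_eq_iff _ _).1 hy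
    refine (exists_sc_zero_f_eq_iff _ _).2
      (invariantVal_injective (restrictCochain_injective G M _ ?_))
    rw [← evalCochain_restrictInvariants, h]
    exact (evalCochain_zero _ _).trans (restrictCochain_zero G M _).symm
  | succ p =>
    obtain ⟨w, hw⟩ := (exists_sc_succ_f_eq_iff _ _ _).1 hy
    have h := (homogeneousCochains_groupRep_d_eq_iff G M p w _).1 hw
    rw [evalCochain_restrictInvariants] at h
    -- The coboundary of `w` is a restriction from the completion, hence uniform. Subtracting `s`
    -- keeps the coboundary and makes the primitive extend to the completion.
    obtain ⟨s, hs, us⟩ := exists_coboundary_isUniform_sub hG p (evalCochain_equivariant G M w)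
      (h ▸ restrictCochain_isUniform G M _ _)
    obtain ⟨c, hc⟩ := exists_invariant_restrictCochain_eq G M
      ((evalCochain_equivariant G M w).sub hs.isEquivariant) us
    refine (exists_sc_succ_f_eq_iff _ _ _).2
      ⟨c, (homogeneousCochains_completionRep_d_eq_iff G M p c y).2 ?_⟩
    rw [hc, coboundary_sub, hs.coboundary_eq_zero, sub_zero, h]

end Restriction

end SerreGood

theorem mainTheorem12 (G : Type u) [Group G] (hG : SerreGood.IsAlmostFree G) :
    SerreGood.IsGood G := by
  intro _ _ M _ _ _ _ _ p
  refine SerreGood.homologyMap_bijective _ (fun x hx => ?_) fun y _ hy => ?_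
  · obtain ⟨y, hy, hw⟩ := SerreGood.exists_cocycle_of_isAlmostFree G M hG p x
      ((SerreGood.sc_g_eq_zero_iff (TopRep.homogeneousCochains (SerreGood.groupRep G M)) p x).1 hx)
    exact ⟨y, (SerreGood.sc_g_eq_zero_iff
      (TopRep.homogeneousCochains (SerreGood.completionRep G M)) p y).2 hy, hw⟩
  · exact SerreGood.exists_primitive_of_isAlmostFree G M hG p y hy
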